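/- Let $\mathrm{PS}(\mathrm{Stoch})$ be the category whose objects are probability spaces $(X,p)$ and whose morphisms $(X,p)\to(Y,q)$ are Markov kernels $f:X\to Y$ with $q(B)=\int_X f(B|x)\,p(dx)$ for all measurable $B\subseteq Y$, modulo $p$-almost sure equality ($f\simeq_p g$ iff for every measurable $B\subseteq Y$, $f(B|x)=g(B|x)$ for $p$-almost every $x$). Let $\mathrm{PS}(\mathrm{Borel})$ be its full subcategory on the standard Borel probability spaces. A morphism $f:(X,p)\to(Y,q)$ is a.s. deterministic if $f$ followed by the copy map $Y\to Y\times Y$ is $p$-a.s. equal to the kernel $x\mapsto f(\cdot|x)\otimes f(\cdot|x)$. Let $M$ be a monoid (of any cardinality) and let $D$ be a functor from $M$, seen as a one-object category, to $\mathrm{PS}(\mathrm{Borel})$, acting on $(X,p)$; each $m\in M$ thus gives a measure-preserving kernel $m:(X,p)\to(X,p)$, up to a.s. equality. Let $(X_{\mathrm{inv}},p_{\mathrm{inv}})$ be the set $X$ with the invariant $\sigma$-algebra, which consists of the measurable sets $A\subseteq X$ such that for every $m\in M$, $m(A|x)=1_A(x)$ for $p$-almost every $x$, and with the restriction of $p$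 to it. An invariant object of a dynamical system acting on $(X,p)$ in one of the two categories is a colimit $r:(X,p)\to(E,q)$ of the diagram in that category, such that for each morphism $g:(E,q)\to(Y,s)$ of the category, $g\circ r$ is a.s. deterministic if and only if $g$ is. Then: 1. $(X_{\mathrm{inv}},p_{\mathrm{inv}})$ is isomorphic in $\mathrm{PS}(\mathrm{Stoch})$ to a standard Borel probability space. 2. Hence $\mathrm{PS}(\mathrm{Borel})$ is closed under invariant objects: (a) $D$ has an invariant object $r:(X,p)\to(E,q)$ in $\mathrm{PS}(\mathrm{Borel})$ which is also an invariant object of $D$ in $\mathrm{PS}(\mathrm{Stoch})$, and for which there is an isomorphism $(X_{\mathrm{inv}},p_{\mathrm{inv}})\cong(E,q)$ of $\mathrm{PS}(\mathrm{Stoch})$ whose composite with the morphism $(X,p)\to(X_{\mathrm{inv}},p_{\mathrm{inv}})$ induced by the identity function is $r$; (b) every invariant object of $D$ in $\mathrm{PS}(\mathrm{Stoch})$ is isomorphic in $\mathrm{PS}(\mathrm{Stoch})$ to a standard Borel probability space. -/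

import Mathlib

open CategoryTheory CategoryTheory.Limits MeasureTheory ProbabilityTheory

universe v u

/-- A probability space: an object of the category `PS(Stoch)`. -/
structure PSStoch : Type (u + 1) where
  /-- The underlying set. -/
  carrier : Type u
  [ms : MeasurableSpace carrier]
  /-- The probability measure. -/
  prob : Measure carrier
  [isProb : IsProbabilityMeasure prob]

namespace PSStoch

instance : CoeSort PSStoch.{u} (Type u) := ⟨PSStoch.carrier⟩

attribute [instance] PSStoch.ms PSStoch.isProb

/-- Almost sure equality of two kernels with respect to a measure `p` on the source: for every
measurable set `B` of the target, `f(B|x) = g(B|x)` for `p`-almost every `x`. -/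
def ASEq {α β : Type*} [MeasurableSpace α] [MeasurableSpace β] (p : Measure α)
    (f g : Kernel α β) : Prop :=
  ∀ B : Set β, MeasurableSet B → ∀ᵐ x ∂p, f x B = g x B

theorem ASEq.refl {α β : Type*} [MeasurableSpace α] [MeasurableSpace β] (p : Measure α)
    (f : Kernel α β) : ASEq p f f := fun _ _ => Filter.Eventually.of_forall fun _ => rfl

theorem ASEq.symm {α β : Type*} [MeasurableSpace α] [MeasurableSpace β] {p : Measure α}
    {f g : Kernel α β} (h : ASEq p f g) : ASEq p g f :=
  fun B hB => (h B hB).mono fun _ hx => hx.symm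

theorem ASEq.trans {α β : Type*} [MeasurableSpace α] [MeasurableSpace β] {p : Measure α}
    {f g k : Kernel α β} (h : ASEq p f g) (h' : ASEq p g k) : ASEq p f k :=
  fun B hB => by filter_upwards [h B hB, h' B hB] with x h1 h2 using h1.trans h2

/-- Almost sure equality, expressed with integrals over measurable sets of the source. -/
theorem asEq_iff_setLIntegral {α β : Type*} [MeasurableSpace α] [MeasurableSpace β]
    {p : Measure α} [IsProbabilityMeasure p] {f g : Kernel α β} :
    ASEq p f g ↔ ∀ A : Set α, MeasurableSet A → ∀ B : Set β, MeasurableSet B →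
      ∫⁻ x in A, f x B ∂p = ∫⁻ x in A, g x B ∂p := by
  constructor
  · intro h A _ B hB
    exact lintegral_congr_ae (ae_restrict_of_ae (h B hB))
  · intro h B hB
    exact ae_eq_of_forall_setLIntegral_eq_of_sigmaFinite
      (f.measurable_coe hB) (g.measurable_coe hB) fun A hA _ => h A hA B hB

/-- Composition of measure-preserving kernels respects almost sure equality. -/
theorem ASEq.comp {α β γ : Type*} [MeasurableSpace α] [MeasurableSpace β] [MeasurableSpace γ]
    {p : Measure α} [IsProbabilityMeasure p] {q : Measure β} {f f' : Kernel α β}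
    {g g' : Kernel β γ} (hpf : p.bind f = q) (hf : ASEq p f f') (hg : ASEq q g g') :
    ASEq p (g ∘ₖ f) (g' ∘ₖ f') := by
  rw [asEq_iff_setLIntegral]
  intro A hA C hC
  have key : ∀ (k : Kernel α β) (l : Kernel β γ), ∫⁻ x in A, (l ∘ₖ k) x C ∂p
      = ∫⁻ y, l y C ∂((p.restrict A).bind k) := by
    intro k l
    rw [Measure.lintegral_bind k.aemeasurable (l.measurable_coe hC).aemeasurable]
    exact lintegral_congr fun x => Kernel.comp_apply' _ _ _ hC
  rw [key, key]
  have hb : (p.restrict A).bind f = (p.restrict A).bind f' := by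
    ext B hB
    rw [Measure.bind_apply hB f.aemeasurable, Measure.bind_apply hB f'.aemeasurable]
    exact lintegral_congr_ae (ae_restrict_of_ae (hf B hB))
  rw [← hb]
  have hac : (p.restrict A).bind f ≪ q := by
    refine Measure.AbsolutelyContinuous.mk fun B hB h0 => ?_
    rw [← hpf, Measure.bind_apply hB f.aemeasurable] at h0
    rw [Measure.bind_apply hB f.aemeasurable]
    exact le_antisymm ((setLIntegral_le_lintegral _ _).trans h0.le) zero_le
  exact lintegral_congr_ae (hac.ae_le (hg C hC))

/-- The pairing of a Markov kernel with itself respects almost sure equality. -/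
theorem ASEq.prod_self {α β : Type*} [MeasurableSpace α] [MeasurableSpace β] {p : Measure α}
    {f g : Kernel α β} [IsMarkovKernel f] [IsMarkovKernel g] (h : ASEq p f g) :
    ASEq p (f ×ₖ f) (g ×ₖ g) := by
  intro B hB
  induction B, hB using MeasurableSpace.induction_on_inter generateFrom_prod.symm
    isPiSystem_prod with
  | empty => simp
  | basic t ht =>
    obtain ⟨B, hB, C, hC, rfl⟩ := ht
    filter_upwards [h B hB, h C hC] with x h1 h2
    simp only [Kernel.prod_apply, Measure.prod_prod, h1, h2]
  | compl t ht ih =>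
    filter_upwards [ih] with x hx
    rw [prob_compl_eq_one_sub ht, prob_compl_eq_one_sub ht, hx]
  | iUnion t hd ht ih =>
    filter_upwards [ae_all_iff.2 ih] with x hx
    rw [measure_iUnion hd ht, measure_iUnion hd ht]
    exact tsum_congr hx

/-- A measure-preserving Markov kernel between probability spaces. -/
structure MPKernel (X Y : PSStoch.{u}) where
  /-- The underlying kernel. -/
  kernel : Kernel X Y
  isMarkov : IsMarkovKernel kernel
  /-- `q(B) = ∫ f(B|x) p(dx)` for every measurable `B`. -/
  preserves : X.prob.bind kernel = Y.prob

attribute [instance] MPKernel.isMarkov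

/-- Almost sure equality as an equivalence relation on measure-preserving kernels. -/
instance MPKernel.setoid (X Y : PSStoch.{u}) : Setoid (MPKernel X Y) where
  r f g := ASEq X.prob f.kernel g.kernel
  iseqv := ⟨fun _ => ASEq.refl _ _, fun h => h.symm, fun h h' => h.trans h'⟩

/-- The identity kernel. -/
noncomputable def MPKernel.id (X : PSStoch.{u}) : MPKernel X X where
  kernel := Kernel.id
  isMarkov := inferInstance
  preserves := Measure.id_comp

/-- Composition of kernels: `(g ∘ f)(C|x) = ∫ g(C|y) f(dy|x)`. -/
noncomputable def MPKernel.comp {X Y Z : PSStoch.{u}} (f : MPKernel X Y) (g : MPKernel Y Z) :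
    MPKernel X Z where
  kernel := g.kernel ∘ₖ f.kernel
  isMarkov := inferInstance
  preserves := by rw [← Measure.comp_assoc, f.preserves, g.preserves]

/-- The category `PS(Stoch)`: probability spaces, and measure-preserving Markov kernels up to
almost sure equality. -/
noncomputable instance : LargeCategory PSStoch.{u} where
  Hom X Y := Quotient (MPKernel.setoid X Y)
  id X := Quotient.mk _ (MPKernel.id X)
  comp {X Y Z} f g := Quotient.map₂ MPKernel.comp
    (fun f _ hf _ _ hg => ASEq.comp f.preserves hf hg) f g
  id_comp f := by
    induction f using Quotient.inductionOn with | h f => ?_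
    refine Quotient.sound ?_
    change ASEq _ (f.kernel ∘ₖ Kernel.id) f.kernel
    rw [Kernel.comp_id]
    exact ASEq.refl _ _
  comp_id f := by
    induction f using Quotient.inductionOn with | h f => ?_
    refine Quotient.sound ?_
    change ASEq _ (Kernel.id ∘ₖ f.kernel) f.kernel
    rw [Kernel.id_comp]
    exact ASEq.refl _ _
  assoc f g h := by
    induction f using Quotient.inductionOn with | h f => ?_
    induction g using Quotient.inductionOn with | h g => ?_
    induction h using Quotient.inductionOn with | h h => ?_
    refine Quotient.sound ?_
    change ASEq _ (h.kernel ∘ₖ (g.kernel ∘ₖ f.kernel)) ((h.kernel ∘ₖ g.kernel) ∘ₖ f.kernel)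
    rw [Kernel.comp_assoc]
    exact ASEq.refl _ _

/-- The morphism of `PS(Stoch)` represented by a measure-preserving kernel. -/
def MPKernel.toHom {X Y : PSStoch.{u}} (f : MPKernel X Y) : X ⟶ Y :=
  Quotient.mk (MPKernel.setoid X Y) f

/-- Almost surely deterministic morphisms: copying the output of `f` is almost surely the same as
running `f` twice, independently, on the same input. -/
def asDeterministic : MorphismProperty PSStoch.{u} := fun X Y f =>
  Quotient.lift (s := MPKernel.setoid X Y)
    (fun k : MPKernel X Y =>
      ASEq X.prob (Kernel.copy Y ∘ₖ k.kernel) (k.kernel ×ₖ k.kernel))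
    (fun k k' (h : ASEq X.prob k.kernel k'.kernel) => by
      have h1 : ASEq X.prob (Kernel.copy Y ∘ₖ k.kernel) (Kernel.copy Y ∘ₖ k'.kernel) :=
        ASEq.comp rfl h (ASEq.refl _ _)
      have h2 := h.prod_self
      exact propext ⟨fun H => (h1.symm.trans H).trans h2,
        fun H => (h1.trans H).trans h2.symm⟩) f

/-- A measurable set `A` is almost surely invariant under a morphism `m : X ⟶ X` of `PS(Stoch)` if
`m(A|x) = 1_A(x)` for almost every `x`. -/
def IsInvariantUnder {X : PSStoch.{u}} (m : X ⟶ X) (A : Set X) : Prop :=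
  Quotient.lift (s := MPKernel.setoid X X)
    (fun k : MPKernel X X =>
      MeasurableSet A ∧ ∀ᵐ x ∂X.prob, k.kernel x A = A.indicator 1 x)
    (fun k k' (h : ASEq X.prob k.kernel k'.kernel) => by
      refine propext (and_congr_right fun hA => ?_)
      exact Filter.eventually_congr ((h A hA).mono fun x hx => by rw [hx])) m

/-- The invariant `σ`-algebra of a dynamical system `D` in `PS(Stoch)`, indexed by a monoid `M`:
the measurable sets which are almost surely invariant under every element of `M`. -/
@[reducible]
def invariantMS {M : Type v} [Monoid M] (D : SingleObj M ⥤ PSStoch.{u}) :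
    MeasurableSpace (D.obj (SingleObj.star M)) where
  MeasurableSet' A := MeasurableSet A ∧
    ∀ m : M, IsInvariantUnder (X := D.obj (SingleObj.star M)) (D.map m) A
  measurableSet_empty := by
    refine ⟨MeasurableSet.empty, fun m => ?_⟩
    induction (D.map m : D.obj (SingleObj.star M) ⟶ D.obj (SingleObj.star M))
      using Quotient.inductionOn with | h k => ?_
    exact ⟨MeasurableSet.empty, by simp⟩
  measurableSet_compl A hA := by
    refine ⟨hA.1.compl, fun m => ?_⟩
    have h := hA.2 m
    revert h
    induction (D.map m : D.obj (SingleObj.star M) ⟶ D.obj (SingleObj.star M))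
      using Quotient.inductionOn with | h k => ?_
    rintro ⟨-, h⟩
    refine ⟨hA.1.compl, ?_⟩
    filter_upwards [h] with x hx
    rw [prob_compl_eq_one_sub hA.1, hx]
    by_cases hxA : x ∈ A <;> simp [hxA]
  measurableSet_iUnion A hA := by
    have hU : MeasurableSet (⋃ i, A i) := MeasurableSet.iUnion fun i => (hA i).1
    refine ⟨hU, fun m => ?_⟩
    have h := fun i => (hA i).2 m
    revert h
    induction (D.map m : D.obj (SingleObj.star M) ⟶ D.obj (SingleObj.star M))
      using Quotient.inductionOn with | h k => ?_
    intro h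
    refine ⟨hU, ?_⟩
    filter_upwards [ae_all_iff.2 fun i => (h i).2] with x hx
    by_cases hxU : x ∈ ⋃ i, A i
    · obtain ⟨i, hi⟩ := Set.mem_iUnion.1 hxU
      rw [Set.indicator_of_mem hxU]
      refine le_antisymm prob_le_one ?_
      calc (1 : ENNReal) = k.kernel x (A i) := by rw [hx i, Set.indicator_of_mem hi]; rfl
        _ ≤ _ := measure_mono (Set.subset_iUnion A i)
    · rw [Set.indicator_of_notMem hxU, measure_iUnion_null_iff]
      intro i
      rw [hx i, Set.indicator_of_notMem fun hi => hxU (Set.mem_iUnion_of_mem i hi)]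

theorem invariantMS_le {M : Type v} [Monoid M] (D : SingleObj M ⥤ PSStoch.{u}) :
    invariantMS D ≤ (D.obj (SingleObj.star M)).ms := fun _ hA => hA.1

/-- The object `(X_inv, p_inv)`: the set `X` on which `D` acts, equipped with the invariant
`σ`-algebra and with the restriction of the measure to it. -/
noncomputable def invariantSpace {M : Type v} [Monoid M] (D : SingleObj M ⥤ PSStoch.{u}) :
    PSStoch.{u} :=
  @PSStoch.mk (D.obj (SingleObj.star M)) (invariantMS D)
    ((D.obj (SingleObj.star M)).prob.trim (invariantMS_le D))
    ⟨by rw [trim_measurableSet_eq (invariantMS_le D) MeasurableSet.univ, measure_univ]⟩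

/-- The identity function, as a measurable function from `X` to `X_inv`. -/
def invariantSpaceMk {M : Type v} [Monoid M] (D : SingleObj M ⥤ PSStoch.{u}) :
    D.obj (SingleObj.star M) → invariantSpace D := fun x => x

theorem measurable_invariantSpaceMk {M : Type v} [Monoid M] (D : SingleObj M ⥤ PSStoch.{u}) :
    Measurable (invariantSpaceMk D) := measurable_id'' (invariantMS_le D)

/-- The morphism `(X, p) ⟶ (X_inv, p_inv)` induced by the identity function. -/
noncomputable def toInvariantSpace {M : Type v} [Monoid M] (D : SingleObj M ⥤ PSStoch.{u}) :
    D.obj (SingleObj.star M) ⟶ invariantSpace D :=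
  MPKernel.toHom
    { kernel := Kernel.deterministic (invariantSpaceMk D) (measurable_invariantSpaceMk D)
      isMarkov := Kernel.isMarkovKernel_deterministic (measurable_invariantSpaceMk D)
      preserves := by
        rw [Measure.deterministic_comp_eq_map]
        exact (trim_eq_map (invariantMS_le D)).symm }

/-- The property of being a standard Borel probability space. -/
def isStandardBorel : ObjectProperty PSStoch.{u} := fun X => StandardBorelSpace X

end PSStoch

/-- The category `PS(Borel)` of standard Borel probability spaces, and measure-preserving Markov
kernels up to almost sure equality. -/
abbrev PSBorel : Type (u + 1) := PSStoch.isStandardBorel.{u}.FullSubcategory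

namespace PSBorel

/-- The inclusion of `PS(Borel)` in `PS(Stoch)`. -/
noncomputable abbrev incl : PSBorel.{u} ⥤ PSStoch.{u} := PSStoch.isStandardBorel.{u}.ι

/-- Almost surely deterministic morphisms of `PS(Borel)`. -/
abbrev asDeterministic : MorphismProperty PSBorel.{u} :=
  PSStoch.asDeterministic.{u}.inverseImage incl

end PSBorel

/-- Let `det` be the class of (almost surely) deterministic morphisms of a category. An invariant
object of a dynamical system `D`, indexed by a monoid, is a cocone `r : X ⟶ X_inv` which is a
colimit of `D`, and such that an invariant morphism `f = g ∘ r` is deterministic if and only if the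
induced morphism `g` is. -/
def IsInvariantObject {C : Type*} [Category C] (det : MorphismProperty C) {M : Type*} [Monoid M]
    {D : SingleObj M ⥤ C} (c : Cocone D) : Prop :=
  Nonempty (IsColimit c) ∧
    ∀ ⦃Y : C⦄ (g : c.pt ⟶ Y), det (c.ι.app (SingleObj.star M) ≫ g) ↔ det g

/-! Two facts combine. First, `X → X_inv` is a colimit cocone in `PS(Stoch)`. If `f` is invariant,
each function `f(B|·)` is bounded and harmonic for every `m`; a zero-variance argument makes it
almost surely constant along `m`, so its level sets are invariant and `f` is already a kernel on
`X_inv` (`exists_toInvariantSpace_comp_eq`). The factorization is unique because measure-preserving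
functions are epi. Second, `X_inv` is isomorphic to a measure on the Cantor space
(`exists_iso_standardBorel`). Since `L¹(X, p)` is separable, countably many invariant sets generate
the rest up to null sets, whatever the size of `M`. They define a map `φ` to the Cantor space, whose
inverse is the disintegration of `p` along `φ` followed by `X → X_inv`. The resulting `r` is given
by a function, which yields the determinism clause, and full faithfulness of the inclusion transfers
everything to `PS(Borel)`. -/

section MeasureTheory

/-! ### Sub-σ-algebras up to null sets -/

/-- A sub-`σ`-algebra of a separable probability space is generated, up to null sets, by countably
many of its members. -/
theorem exists_seq_forall_aestronglyMeasurable_indicator {α : Type*} {m m0 : MeasurableSpace α}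
    (hm : m ≤ m0) (p : Measure α) [IsProbabilityMeasure p] [IsSeparable p] :
    ∃ A : ℕ → Set α, (∀ n, MeasurableSet[m] (A n)) ∧ ∀ B, MeasurableSet[m] B →
      AEStronglyMeasurable[MeasurableSpace.generateFrom (Set.range A)]
        (B.indicator fun _ => (1 : ℝ)) p := by
  have : Fact ((1 : ENNReal) ≠ ⊤) := ⟨ENNReal.one_ne_top⟩
  let F : {B : Set α // MeasurableSet[m] B} → Lp ℝ 1 p := fun B =>
    indicatorConstLp 1 (hm _ B.2) (measure_ne_top p B.1) (1 : ℝ)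
  have : Nonempty (Set.range F) := ⟨⟨_, ⟨∅, @MeasurableSet.empty α m⟩, rfl⟩⟩
  -- Density is taken inside the set of indicators, so that the approximants are themselves
  -- indicators of members of `m`.
  obtain ⟨d, hd⟩ := TopologicalSpace.exists_dense_seq (Set.range F)
  choose a ha using fun n => (d n).2
  refine ⟨fun n => (a n).1, fun n => (a n).2, fun B hB => ?_⟩
  set g := MeasurableSpace.generateFrom (Set.range fun n => (a n).1) with hg
  have hgm : g ≤ m0 := MeasurableSpace.generateFrom_le (by
    rintro _ ⟨n, rfl⟩; exact hm _ (a n).2)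
  have hcl : IsClosed {f : Lp ℝ 1 p | AEStronglyMeasurable[g] f p} :=
    isClosed_aestronglyMeasurable hgm
  have hmem : ∀ y : Set.range F, y.1 ∈ {f : Lp ℝ 1 p | AEStronglyMeasurable[g] f p} := by
    intro y
    refine hd.induction_on y (hcl.preimage continuous_subtype_val) fun n => ?_
    change AEStronglyMeasurable[g] (d n).1 p
    rw [← ha n]
    have : StronglyMeasurable[g] ((a n).1.indicator fun _ => (1 : ℝ)) :=
      stronglyMeasurable_const.indicator (MeasurableSpace.measurableSet_generateFrom ⟨n, rfl⟩)
    exact this.aestronglyMeasurable.congr indicatorConstLp_coeFn.symm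
  exact (show AEStronglyMeasurable[g] (F ⟨B, hB⟩) p from hmem ⟨F ⟨B, hB⟩, _, rfl⟩).congr
    indicatorConstLp_coeFn

/-- A sub-`σ`-algebra of a separable probability space is, up to null sets, pulled back along a map
to the Cantor space. -/
theorem exists_measurable_forall_aestronglyMeasurable_indicator {α : Type*}
    {m m0 : MeasurableSpace α}
    (hm : m ≤ m0) (p : Measure α) [IsProbabilityMeasure p] [IsSeparable p] :
    ∃ φ : α → ULift.{u} (ℕ → Bool), Measurable[m] φ ∧ ∀ B, MeasurableSet[m] B →
      AEStronglyMeasurable[MeasurableSpace.comap φ inferInstance]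
        (B.indicator fun _ => (1 : ℝ)) p := by
  classical
  obtain ⟨A, hA, h⟩ := exists_seq_forall_aestronglyMeasurable_indicator hm p
  -- The `n`-th coordinate tests membership in `A n`, so each `A n` is the preimage of a cylinder.
  refine ⟨fun x => ⟨fun n => decide (x ∈ A n)⟩, ?_, fun B hB => (h B hB).mono ?_⟩
  · exact measurable_up.comp (@measurable_pi_lambda _ _ _ m _ _ fun n => @measurable_to_bool _ m _ (by
      convert hA n using 1; ext x; simp))
  · refine MeasurableSpace.generateFrom_le ?_
    rintro _ ⟨n, rfl⟩
    refine ⟨{y | y.down n = true}, ?_, by ext x; simp⟩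
    exact measurableSet_preimage ((measurable_pi_apply (X := fun _ : ℕ => Bool) n).comp
      measurable_down) (measurableSet_singleton true)

/-- The disintegration of a measure along a map `φ` fixes the sets which are, up to null sets,
pulled back along `φ`. -/
theorem condDistrib_id_ae_eq_indicator {α β : Type*} [MeasurableSpace α] [MeasurableSpace β]
    [StandardBorelSpace α] [Nonempty α] (p : Measure α) [IsProbabilityMeasure p] {φ : α → β}
    (hφ : Measurable φ) {A : Set α} (hA : MeasurableSet A)
    (h : AEStronglyMeasurable[MeasurableSpace.comap φ inferInstance]
      (A.indicator fun _ => (1 : ℝ)) p) :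
    ∀ᵐ x ∂p, condDistrib id φ p (φ x) A = A.indicator 1 x := by
  -- Both sides are versions of the conditional expectation of `1_A` given `φ`.
  have h1 := condDistrib_ae_eq_condExp (μ := p) hφ measurable_id hA
  have h2 := condExp_of_aestronglyMeasurable' hφ.comap_le h
    ((integrable_const (1 : ℝ)).indicator hA)
  filter_upwards [h1, h2] with x h1 h2
  rw [Set.preimage_id, h2] at h1
  rw [← ENNReal.ofReal_toReal (measure_ne_top (condDistrib id φ p (φ x)) A)]
  change ENNReal.ofReal ((condDistrib id φ p (φ x)).real A) = _
  rw [h1]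
  by_cases hx : x ∈ A <;> simp [hx]

/-! ### Bounded harmonic functions -/

/-- A bounded function which is harmonic for a measure-preserving kernel is constant along it. -/
theorem ae_ae_eq_of_integral_eq {α : Type*} [MeasurableSpace α] {p : Measure α}
    [IsProbabilityMeasure p] {k : Kernel α α} [IsMarkovKernel k] (hk : p.bind k = p)
    {g : α → ℝ} (hg : Measurable g) {C : ℝ} (hC : ∀ x, ‖g x‖ ≤ C)
    (h : ∀ᵐ x ∂p, ∫ y, g y ∂k x = g x) : ∀ᵐ x ∂p, ∀ᵐ y ∂k x, g y = g x := by
  have hL : ∀ (ν : Measure α) [IsProbabilityMeasure ν], MemLp g 2 ν := fun ν _ =>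
    MemLp.of_bound hg.aestronglyMeasurable C (Filter.Eventually.of_forall hC)
  have hvar : (fun x => Var[g; k x]) =ᵐ[p] fun x => ∫ y, g y ^ 2 ∂k x - g x ^ 2 := by
    filter_upwards [h] with x hx
    rw [variance_eq_sub (hL (k x)), hx]
    rfl
  have hint : Integrable (fun x => g x ^ 2) p := (hL p).integrable_sq
  have hint' : Integrable (fun x => g x ^ 2) (p.bind k) := by rwa [hk]
  have hi1 : Integrable (fun x => ∫ y, g y ^ 2 ∂k x) p := by
    simpa using ((Measure.integrable_comp_iff hint'.aestronglyMeasurable).1 hint').2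
  have hbind : ∫ x, g x ^ 2 ∂p.bind k = ∫ x, ∫ y, g y ^ 2 ∂k x ∂p := by
    rw [Measure.comp_eq_comp_const_apply] at hint' ⊢
    rw [Kernel.integral_comp hint', Kernel.const_apply]
  -- By harmonicity the variance is `∫ g² dk_x - g(x)²`, and both terms have the same `p`-integral
  -- because `k` preserves `p`.
  have hzero : ∫ x, Var[g; k x] ∂p = 0 := by
    rw [integral_congr_ae hvar, integral_sub hi1 hint, ← hbind, hk, sub_self]
  have hvi : Integrable (fun x => Var[g; k x]) p := (hi1.sub hint).congr hvar.symm
  have hzero' : (fun x => Var[g; k x]) =ᵐ[p] 0 :=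
    (integral_eq_zero_iff_of_nonneg (fun x => variance_nonneg _ _) hvi).1 hzero
  filter_upwards [h, hzero'] with x hx h0
  have h1 : eVar[g; k x] = 0 := by
    rw [← (hL (k x)).ofReal_variance_eq, show Var[g; k x] = 0 from h0, ENNReal.ofReal_zero]
  rw [evariance_eq_zero_iff hg.aemeasurable, hx] at h1
  exact h1

/-- The level sets of a bounded harmonic function of a measure-preserving kernel are invariant. -/
theorem ae_preimage_eq_indicator_of_lintegral_eq {α : Type*} [MeasurableSpace α] {p : Measure α}
    [IsProbabilityMeasure p] {k : Kernel α α} [IsMarkovKernel k] (hk : p.bind k = p)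
    {f : α → ENNReal} (hf : Measurable f) (hf1 : ∀ x, f x ≤ 1)
    (h : ∀ᵐ x ∂p, ∫⁻ y, f y ∂k x = f x) (T : Set ENNReal) :
    ∀ᵐ x ∂p, k x (f ⁻¹' T) = (f ⁻¹' T).indicator 1 x := by
  have hfin : ∀ x, f x ≠ ⊤ := fun x => ne_top_of_le_ne_top ENNReal.one_ne_top (hf1 x)
  have key := ae_ae_eq_of_integral_eq hk hf.ennreal_toReal (C := 1) (fun x => by
      rw [Real.norm_of_nonneg ENNReal.toReal_nonneg]
      exact ENNReal.toReal_le_of_le_ofReal zero_le_one (by simpa using hf1 x)) (by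
      filter_upwards [h] with x hx
      rw [integral_toReal hf.aemeasurable
        (Filter.Eventually.of_forall fun y => (hfin y).lt_top), hx])
  filter_upwards [key] with x hx
  have hx' : ∀ᵐ y ∂k x, f y = f x :=
    hx.mono fun y hy => (ENNReal.toReal_eq_toReal_iff' (hfin y) (hfin x)).1 hy
  -- As `f` is `k x`-almost surely equal to `f x`, the preimage is `k x`-almost everything or almost
  -- nothing; this works for any set `T`.
  by_cases hxT : x ∈ f ⁻¹' T
  · have : (f ⁻¹' T : Set α) =ᵐ[k x] Set.univ :=
      hx'.mono fun y hy => by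
        apply propext
        change f y ∈ T ↔ True
        rw [hy]; simpa using hxT
    rw [measure_congr this, Set.indicator_of_mem hxT, measure_univ]; rfl
  · have : (f ⁻¹' T : Set α) =ᵐ[k x] (∅ : Set α) :=
      hx'.mono fun y hy => by
        apply propext
        change f y ∈ T ↔ False
        rw [hy]; simpa using hxT
    rw [measure_congr this, Set.indicator_of_notMem hxT, measure_empty]

instance ULift.standardBorelSpace {α : Type*} [MeasurableSpace α] [StandardBorelSpace α] :
    StandardBorelSpace (ULift.{u} α) := by
  let _ := upgradeStandardBorel α
  exact ⟨inferInstance, inferInstance, Homeomorph.ulift.isClosedEmbedding.polishSpace⟩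

end MeasureTheory

/-! ### Morphisms given by measure-preserving functions -/

namespace PSStoch

theorem MPKernel.toHom_eq_toHom_iff {X Y : PSStoch.{u}} {f g : MPKernel X Y} :
    f.toHom = g.toHom ↔ ASEq X.prob f.kernel g.kernel := Quotient.eq

theorem MPKernel.toHom_comp {X Y Z : PSStoch.{u}} (f : MPKernel X Y) (g : MPKernel Y Z) :
    f.toHom ≫ g.toHom = (f.comp g).toHom := rfl

theorem MPKernel.toHom_surjective {X Y : PSStoch.{u}} (f : X ⟶ Y) :
    ∃ k : MPKernel X Y, k.toHom = f := Quotient.exists_rep f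

/-- The kernel of a measure-preserving function. -/
noncomputable def MPKernel.ofFun {X Y : PSStoch.{u}} (φ : X → Y)
    (hφ : MeasurePreserving φ X.prob Y.prob) : MPKernel X Y where
  kernel := Kernel.deterministic φ hφ.measurable
  isMarkov := Kernel.isMarkovKernel_deterministic hφ.measurable
  preserves := by rw [Measure.deterministic_comp_eq_map, hφ.map_eq]

/-- The morphism of `PS(Stoch)` given by a measure-preserving function. -/
noncomputable def ofFun {X Y : PSStoch.{u}} (φ : X → Y)
    (hφ : MeasurePreserving φ X.prob Y.prob) : X ⟶ Y := (MPKernel.ofFun φ hφ).toHom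

/-- Since `q` is the image of `p`, a measurable condition on `φ x` holds `p`-a.e. exactly when it
holds `q`-a.e. on the target. Both the epi property and the reflection of determinism rest on this.
-/
theorem asEq_comp_deterministic_iff {α β γ : Type*} [MeasurableSpace α] [MeasurableSpace β]
    [MeasurableSpace γ] {p : Measure α} {q : Measure β} {φ : α → β}
    (hφ : MeasurePreserving φ p q) {f g : Kernel β γ} :
    ASEq p (f ∘ₖ Kernel.deterministic φ hφ.measurable)
      (g ∘ₖ Kernel.deterministic φ hφ.measurable) ↔ ASEq q f g := by
  refine forall₂_congr fun B hB => ?_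
  simp only [Kernel.comp_deterministic_eq_comap, Kernel.comap_apply]
  rw [← hφ.map_eq, ae_map_iff hφ.aemeasurable
    (measurableSet_eq_fun (f.measurable_coe hB) (g.measurable_coe hB))]

theorem ofFun_comp_ofFun {X Y Z : PSStoch.{u}} {φ : X → Y} {ψ : Y → Z}
    (hφ : MeasurePreserving φ X.prob Y.prob) (hψ : MeasurePreserving ψ Y.prob Z.prob) :
    ofFun φ hφ ≫ ofFun ψ hψ = ofFun (ψ ∘ φ) (hψ.comp hφ) := by
  refine MPKernel.toHom_eq_toHom_iff.2 ?_
  change ASEq _ (Kernel.deterministic ψ hψ.measurable ∘ₖ Kernel.deterministic φ hφ.measurable)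
    (Kernel.deterministic _ (hψ.comp hφ).measurable)
  rw [Kernel.deterministic_comp_deterministic]
  exact ASEq.refl _ _

instance epi_ofFun {X Y : PSStoch.{u}} {φ : X → Y} (hφ : MeasurePreserving φ X.prob Y.prob) :
    Epi (ofFun φ hφ) where
  left_cancellation g h H := by
    obtain ⟨g, rfl⟩ := MPKernel.toHom_surjective g
    obtain ⟨h, rfl⟩ := MPKernel.toHom_surjective h
    exact MPKernel.toHom_eq_toHom_iff.2
      ((asEq_comp_deterministic_iff hφ).1 (MPKernel.toHom_eq_toHom_iff.1 H))

theorem asDeterministic_toHom_iff {X Y : PSStoch.{u}} {k : MPKernel X Y} :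
    asDeterministic k.toHom ↔
      ASEq X.prob (Kernel.copy Y ∘ₖ k.kernel) (k.kernel ×ₖ k.kernel) := Iff.rfl

/-- Precomposition with a measure-preserving function preserves and reflects almost sure
determinism. -/
theorem asDeterministic_ofFun_comp_iff {X Y Z : PSStoch.{u}} {φ : X → Y}
    (hφ : MeasurePreserving φ X.prob Y.prob) (g : Y ⟶ Z) :
    asDeterministic (ofFun φ hφ ≫ g) ↔ asDeterministic g := by
  obtain ⟨k, rfl⟩ := MPKernel.toHom_surjective g
  rw [ofFun, MPKernel.toHom_comp, asDeterministic_toHom_iff, asDeterministic_toHom_iff,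
    ← asEq_comp_deterministic_iff hφ]
  -- Pairing commutes with precomposition here because the first map is a function; a random input
  -- would correlate the two copies.
  have h : (k.kernel ×ₖ k.kernel) ∘ₖ Kernel.deterministic φ hφ.measurable =
      (k.kernel ∘ₖ Kernel.deterministic φ hφ.measurable) ×ₖ
        (k.kernel ∘ₖ Kernel.deterministic φ hφ.measurable) := by
    ext1 x
    simp only [Kernel.comp_deterministic_eq_comap, Kernel.comap_apply, Kernel.prod_apply]
  rw [h, Kernel.comp_assoc]
  rfl

/-! ### The invariant σ-algebra as a colimit -/

section Invariant

variable {M : Type v} [Monoid M] (F : SingleObj M ⥤ PSStoch.{u})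

theorem measurePreserving_invariantSpaceMk :
    MeasurePreserving (invariantSpaceMk F) (F.obj (SingleObj.star M)).prob
      (invariantSpace F).prob :=
  ⟨measurable_invariantSpaceMk F, (trim_eq_map (invariantMS_le F)).symm⟩

theorem toInvariantSpace_eq_ofFun :
    toInvariantSpace F = ofFun (invariantSpaceMk F) (measurePreserving_invariantSpaceMk F) := rfl

instance epi_toInvariantSpace : Epi (toInvariantSpace F) :=
  epi_ofFun (measurePreserving_invariantSpaceMk F)

variable {F}

theorem isInvariantUnder_toHom_iff {X : PSStoch.{u}} {k : MPKernel X X} {A : Set X} :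
    IsInvariantUnder k.toHom A ↔
      MeasurableSet A ∧ ∀ᵐ x ∂X.prob, k.kernel x A = A.indicator 1 x := Iff.rfl

/-- The identity function `X → X_inv` is an invariant morphism. -/
theorem map_comp_toInvariantSpace (m : M) :
    (F.map m : F.obj (SingleObj.star M) ⟶ F.obj (SingleObj.star M)) ≫
      toInvariantSpace F = toInvariantSpace F := by
  obtain ⟨k, hk⟩ := MPKernel.toHom_surjective
    (F.map m : F.obj (SingleObj.star M) ⟶ F.obj (SingleObj.star M))
  rw [← hk]
  refine MPKernel.toHom_eq_toHom_iff.2 fun A hA => ?_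
  have h : IsInvariantUnder k.toHom A := hk ▸ hA.2 m
  filter_upwards [(isInvariantUnder_toHom_iff.1 h).2] with x hx
  change (Kernel.deterministic (invariantSpaceMk F) (measurable_invariantSpaceMk F) ∘ₖ k.kernel) x A
    = Kernel.deterministic (invariantSpaceMk F) (measurable_invariantSpaceMk F) x A
  rw [Kernel.deterministic_comp_eq_map, Kernel.map_apply' _ (measurable_invariantSpaceMk F) _ hA,
    Kernel.deterministic_apply' _ _ hA]
  exact hx

/-- Every invariant morphism factors through `X_inv`. -/
theorem exists_toInvariantSpace_comp_eq {Y : PSStoch.{u}} (f : F.obj (SingleObj.star M) ⟶ Y)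
    (hf : ∀ m : M, (F.map m : F.obj (SingleObj.star M) ⟶ F.obj (SingleObj.star M)) ≫
      f = f) : ∃ g, toInvariantSpace F ≫ g = f := by
  obtain ⟨k, rfl⟩ := MPKernel.toHom_surjective f
  -- The chosen representative itself is measurable for the invariant σ-algebra: invariance of `f`
  -- says that `k(B|·)` is harmonic almost everywhere, which is enough for its level sets to be
  -- invariant.
  have hmeas : Measurable[invariantMS F] k.kernel := by
    refine @Measure.measurable_of_measurable_coe _ _ _ (invariantMS F) _ fun B hB T hT => ?_
    refine ⟨k.kernel.measurable_coe hB hT, fun m => ?_⟩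
    obtain ⟨l, hl⟩ := MPKernel.toHom_surjective
      (F.map m : F.obj (SingleObj.star M) ⟶ F.obj (SingleObj.star M))
    have hm := hf m
    rw [← hl] at hm
    change IsInvariantUnder (F.map m : F.obj (SingleObj.star M) ⟶ F.obj (SingleObj.star M)) _
    rw [← hl]
    refine isInvariantUnder_toHom_iff.2 ⟨k.kernel.measurable_coe hB hT, ?_⟩
    refine ae_preimage_eq_indicator_of_lintegral_eq l.preserves (k.kernel.measurable_coe hB)
      (fun x => prob_le_one) ?_ T
    filter_upwards [MPKernel.toHom_eq_toHom_iff.1 hm B hB] with x hx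
    rw [← hx]
    exact (Kernel.comp_apply' _ _ _ hB).symm
  let k' : Kernel (invariantSpace F) Y := ⟨k.kernel, hmeas⟩
  have hk' : k' ∘ₖ Kernel.deterministic (invariantSpaceMk F) (measurable_invariantSpaceMk F) =
      k.kernel := by
    rw [Kernel.comp_deterministic_eq_comap]
    rfl
  refine ⟨MPKernel.toHom ⟨k', ⟨fun x => k.isMarkov.isProbabilityMeasure x⟩, ?_⟩, ?_⟩
  · rw [← (measurePreserving_invariantSpaceMk F).map_eq,
      ← Measure.deterministic_comp_eq_map (measurable_invariantSpaceMk F), Measure.comp_assoc, hk',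
      k.preserves]
  · refine MPKernel.toHom_eq_toHom_iff.2 ?_
    change ASEq _ (k' ∘ₖ Kernel.deterministic (invariantSpaceMk F)
      (measurable_invariantSpaceMk F)) k.kernel
    rw [hk']
    exact ASEq.refl _ _

/-- A cocone isomorphic to `X_inv` under `X` is a colimit. -/
theorem nonempty_isColimit_of_iso (c : Cocone F) (e : invariantSpace F ≅ c.pt)
    (h : toInvariantSpace F ≫ e.hom = c.ι.app (SingleObj.star M)) : Nonempty (IsColimit c) := by
  have key : ∀ s : Cocone F, ∃ g, toInvariantSpace F ≫ g = s.ι.app (SingleObj.star M) :=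
    fun s => exists_toInvariantSpace_comp_eq _ fun m => s.w m
  choose d hd using key
  refine ⟨⟨fun s => e.inv ≫ d s, fun s j => ?_, fun s g hg => ?_⟩⟩
  · change c.ι.app (SingleObj.star M) ≫ _ = s.ι.app (SingleObj.star M)
    rw [← h, Category.assoc, e.hom_inv_id_assoc, hd]
  · rw [Iso.eq_inv_comp, ← cancel_epi (toInvariantSpace F), hd, ← Category.assoc, h]
    exact hg _

/-! ### Standard Borel model of the invariant space -/

variable (F)

/-- The space of invariant sets of a standard Borel dynamical system is isomorphic to a standard
Borel space, by a measure-preserving function. -/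
theorem exists_iso_standardBorel (hX : isStandardBorel (F.obj (SingleObj.star M))) :
    ∃ E : PSStoch.{u}, isStandardBorel E ∧ ∃ (φ : invariantSpace F → E)
      (hφ : MeasurePreserving φ (invariantSpace F).prob E.prob) (e : invariantSpace F ≅ E),
      e.hom = ofFun φ hφ := by
  have : StandardBorelSpace (F.obj (SingleObj.star M)) := hX
  let X := F.obj (SingleObj.star M)
  have : Nonempty X := nonempty_of_isProbabilityMeasure X.prob
  obtain ⟨φ, hφ, h⟩ := exists_measurable_forall_aestronglyMeasurable_indicator.{u}
    (invariantMS_le F) X.prob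
  have hφX : Measurable φ := hφ.mono (invariantMS_le F) le_rfl
  have := Measure.isProbabilityMeasure_map (μ := X.prob) hφX.aemeasurable
  let E : PSStoch.{u} := ⟨ULift.{u} (ℕ → Bool), X.prob.map φ⟩
  let φ' : invariantSpace F → E := φ
  have hφm : Measurable φ' := hφ
  have hφ' : MeasurePreserving φ' (invariantSpace F).prob E.prob := by
    refine ⟨hφm, ?_⟩
    rw [← (measurePreserving_invariantSpaceMk F).map_eq,
      Measure.map_map hφm (measurable_invariantSpaceMk F)]
    rfl
  -- The disintegration lands in `X`, which is standard Borel, and is only afterwards pushed to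
  -- `X_inv`.
  let s : MPKernel E X :=
    { kernel := condDistrib id φ X.prob
      isMarkov := inferInstance
      preserves := by
        change condDistrib id φ X.prob ∘ₘ X.prob.map φ = X.prob
        rw [condDistrib_comp_map hφX.aemeasurable aemeasurable_id, Measure.map_id] }
  have hs : ofFun φ' hφ' ≫ s.toHom ≫ toInvariantSpace F = 𝟙 _ := by
    rw [← cancel_epi (toInvariantSpace F), Category.comp_id]
    refine MPKernel.toHom_eq_toHom_iff.2 fun A hA => ?_
    filter_upwards [condDistrib_id_ae_eq_indicator X.prob hφX (invariantMS_le F A hA) (h A hA)]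
      with x hx
    change (((Kernel.deterministic (invariantSpaceMk F) (measurable_invariantSpaceMk F) ∘ₖ
      condDistrib id φ X.prob) ∘ₖ Kernel.deterministic φ' hφ'.measurable) ∘ₖ
        Kernel.deterministic (invariantSpaceMk F) (measurable_invariantSpaceMk F)) x A =
      Kernel.deterministic (invariantSpaceMk F) (measurable_invariantSpaceMk F) x A
    rw [Kernel.comp_deterministic_eq_comap, Kernel.comap_apply, Kernel.comp_deterministic_eq_comap,
      Kernel.comap_apply, Kernel.deterministic_comp_eq_map,
      Kernel.map_apply' _ (measurable_invariantSpaceMk F) _ hA, Kernel.deterministic_apply' _ _ hA]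
    exact hx
  refine ⟨E, inferInstanceAs (StandardBorelSpace (ULift.{u} (ℕ → Bool))), φ', hφ',
    ⟨ofFun φ' hφ', s.toHom ≫ toInvariantSpace F, hs, ?_⟩, rfl⟩
  -- A split monomorphism that is epi is an isomorphism.
  rw [← cancel_epi (ofFun φ' hφ'), ← Category.assoc, hs, Category.id_comp, Category.comp_id]

end Invariant

end PSStoch

/-! ### Invariant objects in the two categories -/

theorem mainTheorem5 {M : Type v} [Monoid M] (D : SingleObj M ⥤ PSBorel.{u}) :
    -- the space with its a.s. invariant sigma-algebra is standard Borel up to isomorphism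
    (∃ E : PSBorel.{u}, Nonempty (PSStoch.invariantSpace (D ⋙ PSBorel.incl) ≅ PSBorel.incl.obj E)) ∧
    -- an invariant object of `D` exists in `PS(Borel)`; it is also an invariant object in
    -- `PS(Stoch)`, and it is isomorphic there to `X_inv`, compatibly with the maps from `X`
    (∃ c : Cocone D, IsInvariantObject PSBorel.asDeterministic c ∧
      IsInvariantObject PSStoch.asDeterministic (PSBorel.incl.mapCocone c) ∧
      ∃ e : PSStoch.invariantSpace (D ⋙ PSBorel.incl) ≅ PSBorel.incl.obj c.pt,
        PSStoch.toInvariantSpace (D ⋙ PSBorel.incl) ≫ e.hom =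
          PSBorel.incl.map (c.ι.app (SingleObj.star M))) ∧
    -- every invariant object of `D` in `PS(Stoch)` lies in `PS(Borel)` up to isomorphism
    (∀ c : Cocone (D ⋙ PSBorel.incl), IsInvariantObject PSStoch.asDeterministic c →
      ∃ E : PSBorel.{u}, Nonempty (c.pt ≅ PSBorel.incl.obj E)) := by
  obtain ⟨E, hE, φ, hφ, e, he⟩ := PSStoch.exists_iso_standardBorel (D ⋙ PSBorel.incl)
    (D.obj (SingleObj.star M)).property
  let E' : PSBorel.{u} := ⟨E, hE⟩
  let r : D.obj (SingleObj.star M) ⟶ E' :=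
    PSBorel.incl.preimage (PSStoch.toInvariantSpace (D ⋙ PSBorel.incl) ≫ e.hom)
  have hr : PSBorel.incl.map r = PSStoch.toInvariantSpace (D ⋙ PSBorel.incl) ≫ e.hom :=
    PSBorel.incl.map_preimage _
  let c : Cocone D :=
    { pt := E'
      ι :=
        { app := fun _ => r
          naturality := fun _ _ m => by
            apply PSBorel.incl.map_injective
            change PSBorel.incl.map (D.map m ≫ r) = PSBorel.incl.map (r ≫ 𝟙 _)
            rw [Category.comp_id, Functor.map_comp, hr, ← Category.assoc]
            exact congrArg (· ≫ e.hom)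
              (PSStoch.map_comp_toInvariantSpace (F := D ⋙ PSBorel.incl) m) } }
  obtain ⟨hc⟩ := PSStoch.nonempty_isColimit_of_iso (PSBorel.incl.mapCocone c) e hr.symm
  have hdet : ∀ ⦃Y : PSStoch.{u}⦄ (g : PSBorel.incl.obj E' ⟶ Y),
      PSStoch.asDeterministic (PSBorel.incl.map r ≫ g) ↔ PSStoch.asDeterministic g := by
    intro Y g
    -- Both factors of `r` are functions, hence so is `r`, and precomposition with it reflects
    -- determinism.
    rw [hr, he, PSStoch.toInvariantSpace_eq_ofFun, PSStoch.ofFun_comp_ofFun]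
    exact PSStoch.asDeterministic_ofFun_comp_iff _ g
  refine ⟨⟨E', ⟨e⟩⟩, ⟨c, ⟨⟨isColimitOfReflects PSBorel.incl hc⟩, fun Y g => ?_⟩,
    ⟨⟨hc⟩, fun Y g => hdet g⟩, e, hr.symm⟩, fun c' hc' => ?_⟩
  · change PSStoch.asDeterministic (PSBorel.incl.map (r ≫ g)) ↔ _
    rw [Functor.map_comp]
    exact hdet _
  · obtain ⟨⟨hc'⟩, -⟩ := hc'
    -- Colimits in `PS(Stoch)` are unique up to isomorphism, and `E'` is the vertex of one.
    exact ⟨E', ⟨hc'.coconePointUniqueUpToIso hc⟩⟩
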